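/- A \emph{fixed-width arithmetic} (FA) $F$ with $b$ bits consists of a set $V\subset\mathbb{Q}$ of at most $2^b$ representable values, $0\in V$, and a rule assigning to the exact real result of an operation a value in $V$: results are rounded up or down to a neighbouring representable value, and overflows are handled by saturation or by wrap-around; a quotient by $0$ is some fixed representable value. All operations ($+$, $\cdot$, $/$, $\exp$) are carried out exactly and then rounded into $V$, and sums are accumulated from left to right. A \emph{transformer encoder} (TE) $T$ over a finite alphabet $\Sigma$ working over $F$ consists of a positional embedding $\mathit{emb}:\Sigma\times\mathbb{N}\to V^{d_0}$, of $L$ layers, and of an output function $\mathit{out}:V^{d_L}\to V$. Layer $i$ has $h_i$ attention heads and a combination function $\mathit{comb}_i$ with values in $V^{d_i}$; its $j$-th head has a scoring function $\mathit{score}_{i,j}:V^{d_{i-1}}\times V^{d_{i-1}}\to V$, a matrix $W_{i,j}$ over $V$, and a normalisation $\mathit{norm}_{i,j}$. On a word $w=a_1\cdots a_n\in\Sigma^+$ one puts $x^0_m=\mathit{emb}(a_m,m)$ and $x^i_m=\mathit{comb}_i(x^{i-1}_m,y^i_{m,1},\dots,y^i_{m,h_i})$, where $y^i_{m,j}=\sum_{k=1}^n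 \mathit{norm}_{i,j}(k,s_1,\dots,s_n)\,(W_{i,j}x^{i-1}_k)$ with $s_k=\mathit{score}_{i,j}(x^{i-1}_m,x^{i-1}_k)$, and $T(w)=\mathit{out}(x^L_n)$; all computations are carried out in $F$. The TE $T$ is \emph{additive-periodical} if $\mathit{emb}(a,i)=\mathit{emb}'(a)+\mathit{pos}(i)$ (computed in $F$), where $\mathit{pos}(i+p)=\mathit{pos}(i)$ for all $i$, for some $p\ge 1$. Put $|T|=|\Sigma|+L+H+D+p+b$, where $H=\max_i h_i$, $D$ is the maximal dimension of the vectors occurring in computations of $T$, and $p$ is the least period. Let $\mathcal{T}$ be a class of additive-periodical TE, each working over some FA (possibly different ones for different TE), all of whose normalisations are softmax, $\mathrm{softmax}(k,s_1,\dots,s_n)=e^{s_k}/\sum_l e^{s_l}$, or hardmax, $\mathrm{hardmax}(k,s_1,\dots,s_n)=1/m$ if $s_k$ is the maximum of $s_1,\dots,s_n$ and is attained at $m$ positions, and $0$ if it is not the maximum. Let the TE in $\mathcal{T}$ be represented by bit strings such that (i) $|T|$ is bounded by a polynomial in the length of the representation of $T$, and (ii) $\mathcal{T}$ has the polynomial evaluation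 property: there is a deterministic Turing machine that, given the representation of $T\in\mathcal{T}$ and a word $w$ of symbols (symbols being coded as natural numbers), decides in time polynomial in the length of this input whether $w\in\Sigma^+$ and $T(w)=1$. \textbf{Theorem.} The satisfiability problem $\textsc{trSat}[\mathcal{T}]$ (given a representation of $T\in\mathcal{T}$ with alphabet $\Sigma$, decide whether there is $w\in\Sigma^+$ with $T(w)=1$) is in $\mathrm{NEXPTIME}$: there are a nondeterministic Turing machine and a polynomial $q$ such that, for every representation $x$ of some $T\in\mathcal{T}$, the machine has an accepting computation on $x$ if and only if such a word $w$ exists, and in that case it has an accepting computation with at most $2^{q(|x|)}$ steps. -/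

import Mathlib

/-! ### Fixed-width arithmetics -/

/-- `r` is a representable value obtained from the real number `y` by rounding up or down: nothing
representable lies strictly between `y` and `r`. If `y` exceeds all representable values then `r`
is the largest one, if it is below all of them then `r` is the smallest one (saturation). -/
def IsRounding (values : Finset ℚ) (y : ℝ) (r : ℚ) : Prop :=
  r ∈ values ∧ ∀ v ∈ values, (y ≤ (v : ℝ) → r ≤ v) ∧ ((v : ℝ) ≤ y → v ≤ r)

/-- Every real is rounded up or down, overflows are saturated. -/
def IsSaturating (values : Finset ℚ) (round : ℝ → ℚ) : Prop :=
  ∀ x : ℝ, IsRounding values x (round x)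

/-- Every real is first shifted by a multiple of the modulus `M`, where `M` exceeds the diameter
of the set of representable values, to a number `y` lying in that range or in one of the two gaps
next to it, and `y` is rounded up or down (wrap-around). -/
def IsWrapAround (values : Finset ℚ) (round : ℝ → ℚ) : Prop :=
  ∃ M : ℝ, (∀ u ∈ values, ∀ v ∈ values, (u : ℝ) - v < M) ∧
    ∀ x : ℝ, ∃ k : ℤ,
      (∀ v ∈ values, (v : ℝ) - M < x + k * M ∧ x + k * M < v + M) ∧
      IsRounding values (x + k * M) (round x)

/-- A fixed-width arithmetic: finitely many rational values, representable with `bits` bits, and a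
rule `round` that turns the exact result of an operation into a representable value, rounding up
or down and treating overflows by saturation or by wrap-around. -/
structure FixedWidthArithmetic where
  /-- the number `b` of bits -/
  bits : ℕ
  /-- the representable numbers -/
  values : Finset ℚ
  card_values_le : values.card ≤ 2 ^ bits
  zero_mem : (0 : ℚ) ∈ values
  /-- rounding and overflow handling -/
  round : ℝ → ℚ
  round_mem : ∀ x, round x ∈ values
  round_spec : IsSaturating values round ∨ IsWrapAround values round
  /-- the representable value that the arithmetic assigns to the quotient `a / 0` -/
  divZero : ℚ → ℚ
  divZero_mem : ∀ a ∈ values, divZero a ∈ values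

namespace FixedWidthArithmetic

variable (F : FixedWidthArithmetic)

/-- The values of the arithmetic. -/
abbrev Val : Type := {q : ℚ // q ∈ F.values}

/-- Vectors over the arithmetic. -/
abbrev Vec (d : ℕ) : Type := Fin d → F.Val

variable {F}

/-- The value representing a real number. -/
def rnd (x : ℝ) : F.Val := ⟨F.round x, F.round_mem x⟩

def zero : F.Val := ⟨0, F.zero_mem⟩

noncomputable def one : F.Val := rnd 1

noncomputable def add (a b : F.Val) : F.Val := rnd ((a.1 : ℝ) + (b.1 : ℝ))

noncomputable def mul (a b : F.Val) : F.Val := rnd ((a.1 : ℝ) * (b.1 : ℝ))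

noncomputable def div (a b : F.Val) : F.Val :=
  if b.1 = 0 then ⟨F.divZero a.1, F.divZero_mem a.1 a.2⟩ else rnd ((a.1 : ℝ) / (b.1 : ℝ))

noncomputable def exp (a : F.Val) : F.Val := rnd (Real.exp (a.1 : ℝ))

/-- Sums are accumulated from left to right, each partial sum being a value of the arithmetic. -/
noncomputable def sum (l : List F.Val) : F.Val := l.foldl add zero

/-- The linear map given by a matrix, carried out in the arithmetic. -/
noncomputable def mulVec {m n : ℕ} (W : Matrix (Fin m) (Fin n) F.Val) (x : F.Vec n) : F.Vec m :=
  fun c => sum (List.ofFn fun k => mul (W c k) (x k))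

variable (F)

/-- `softmax (i, s₁, …, sₙ) = exp sᵢ / ∑ⱼ exp sⱼ`, carried out in the arithmetic
(positions are counted from `0`). -/
noncomputable def softmax (i : ℕ) (s : List F.Val) : F.Val :=
  div (exp (s.getD i zero)) (sum (s.map exp))

/-- `hardmax (i, s₁, …, sₙ) = 1 / m` if `sᵢ` is maximal and is attained at `m` positions, and `0`
if `sᵢ` is not maximal, carried out in the arithmetic (positions are counted from `0`). -/
noncomputable def hardmax (i : ℕ) (s : List F.Val) : F.Val :=
  if ∀ t ∈ s, t ≤ s.getD i zero then
    div one (sum (s.map fun t => if t = s.getD i zero then one else zero))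
  else zero

end FixedWidthArithmetic

/-! ### Transformer encoders working over a fixed-width arithmetic -/

open FixedWidthArithmetic in
/-- An attention head on vectors of dimension `d`. -/
structure AttentionHead (F : FixedWidthArithmetic) (d : ℕ) where
  outDim : ℕ
  score : F.Vec d → F.Vec d → F.Val
  /-- the normalisation: position and sequence of scores to weight -/
  norm : ℕ → List F.Val → F.Val
  W : Matrix (Fin outDim) (Fin d) F.Val

/-- The pooling `(x₁, …, xₙ, s₁, …, sₙ) ↦ ∑ᵢ norm (i, s₁, …, sₙ) (W xᵢ)`. -/
noncomputable def AttentionHead.pool {F : FixedWidthArithmetic} {d : ℕ} (a : AttentionHead F d)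
    (X : List (F.Vec d)) (s : List F.Val) : F.Vec a.outDim :=
  fun c => FixedWidthArithmetic.sum
    (X.mapIdx fun i x => FixedWidthArithmetic.mul (a.norm i s)
      (FixedWidthArithmetic.mulVec a.W x c))

/-- An encoder layer with `numHeads` attention heads, from dimension `d` to dimension `d'`. -/
structure EncoderLayer (F : FixedWidthArithmetic) (d d' : ℕ) where
  numHeads : ℕ
  head : Fin numHeads → AttentionHead F d
  comb : F.Vec d → (∀ j, F.Vec (head j).outDim) → F.Vec d'

/-- The sequence of vectors computed by a layer. -/
noncomputable def EncoderLayer.apply {F : FixedWidthArithmetic} {d d' : ℕ}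
    (l : EncoderLayer F d d') (X : List (F.Vec d)) : List (F.Vec d') :=
  X.map fun x => l.comb x fun j => (l.head j).pool X (X.map fun y => (l.head j).score x y)

/-- A transformer encoder over the alphabet `Fin numSymbols`, working over the arithmetic `F`. -/
structure TransformerEncoder (F : FixedWidthArithmetic) where
  /-- the size of the alphabet -/
  numSymbols : ℕ
  /-- the number `L` of layers -/
  depth : ℕ
  /-- `dim i` is the dimension of the vectors computed by the `i`-th layer, `dim 0` that of the
  embedding; only `dim 0, …, dim depth` matter -/
  dim : ℕ → ℕ
  emb : Fin numSymbols → ℕ → F.Vec (dim 0)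
  /-- layer number `i + 1` -/
  layer : ∀ i : Fin depth, EncoderLayer F (dim i) (dim (i + 1))
  out : F.Vec (dim depth) → F.Val

namespace TransformerEncoder

variable {F : FixedWidthArithmetic} (T : TransformerEncoder F)

/-- The sequence of vectors after the first `i` layers; positions of the word are
`1, 2, …` for the embedding. -/
noncomputable def hidden (w : List (Fin T.numSymbols)) :
    (i : ℕ) → i ≤ T.depth → List (F.Vec (T.dim i))
  | 0, _ => w.mapIdx fun m a => T.emb a (m + 1)
  | i + 1, h => (T.layer ⟨i, h⟩).apply (hidden w i (Nat.le_of_succ_le h))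

/-- The output `T(w)`, computed from the vector of the last symbol; `none` iff `w` is empty. -/
noncomputable def output (w : List (Fin T.numSymbols)) : Option F.Val :=
  (T.hidden w T.depth le_rfl).getLast?.map T.out

/-- `T` accepts `w`: the word is non-empty and `T(w) = 1`. -/
def Accepts (w : List (Fin T.numSymbols)) : Prop :=
  ∃ v, T.output w = some v ∧ v.1 = 1

/-- `T` is a positive instance of the satisfiability problem. -/
def Satisfiable : Prop := ∃ w : List (Fin T.numSymbols), w ≠ [] ∧ T.Accepts w

/-- The embedding is a sum `emb'(a) + pos(i)` where `pos` has period `p ≥ 1`. -/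
def AdditivePeriodicalWith (p : ℕ) : Prop :=
  1 ≤ p ∧ ∃ (emb' : Fin T.numSymbols → F.Vec (T.dim 0)) (pos : ℕ → F.Vec (T.dim 0)),
    (∀ i, pos (i + p) = pos i) ∧
    ∀ a i, T.emb a i = fun c => FixedWidthArithmetic.add (emb' a c) (pos i c)

def AdditivePeriodical : Prop := ∃ p, T.AdditivePeriodicalWith p

/-- Every normalisation is softmax or hardmax. -/
def SoftmaxOrHardmax : Prop :=
  ∀ i j, ((T.layer i).head j).norm = F.softmax ∨ ((T.layer i).head j).norm = F.hardmax

/-- The maximum width `H`. -/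
def width : ℕ := Finset.univ.sup fun i => (T.layer i).numHeads

/-- The maximal dimension `D` of the vectors occurring in computations. -/
def dimensionality : ℕ :=
  max ((Finset.range (T.depth + 1)).sup T.dim)
    (Finset.univ.sup fun i => Finset.univ.sup fun j => ((T.layer i).head j).outDim)

/-- The (least) period of an additive-periodical embedding. -/
noncomputable def period : ℕ := sInf {p | T.AdditivePeriodicalWith p}

/-- The complexity `|T| = |Σ| + L + H + D + p + b`. -/
noncomputable def complexity : ℕ :=
  T.numSymbols + T.depth + T.width + T.dimensionality + T.period + F.bits

/-- Acceptance for words whose symbols are given as natural numbers; a word with a symbol outside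
the alphabet is not accepted. -/
def AcceptsNat (w : List ℕ) : Prop :=
  ∃ u : List (Fin T.numSymbols), u.map Fin.val = w ∧ T.Accepts u

end TransformerEncoder

/-! ### Nondeterministic exponential time -/

/-- A nondeterministic machine: a multi-stack Turing machine with a second program, so that each
step may follow either program, and a set of accepting internal states. -/
structure NondetTM where
  tm : Turing.FinTM2
  alt : tm.Λ → Turing.TM2.Stmt tm.Γ tm.Λ tm.σ
  accepting : Set tm.σ
  /-- inputs are bit strings -/
  inputAlphabet : tm.Γ tm.k₀ ≃ Bool

namespace NondetTM

variable (M : NondetTM)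

/-- One step of the machine. -/
def Step (c c' : M.tm.Cfg) : Prop :=
  Turing.TM2.step M.tm.m c = some c' ∨ Turing.TM2.step M.alt c = some c'

/-- `c'` is reachable from `c` in exactly `n` steps. -/
def ReachesIn : ℕ → M.tm.Cfg → M.tm.Cfg → Prop
  | 0, c, c' => c = c'
  | n + 1, c, c' => ∃ d, M.Step c d ∧ ReachesIn n d c'

/-- On input `x` some computation halts in an accepting state after exactly `n` steps. -/
def AcceptsIn (x : List Bool) (n : ℕ) : Prop :=
  ∃ c : M.tm.Cfg, M.ReachesIn n (Turing.initList M.tm (x.map M.inputAlphabet.symm)) c ∧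
    c.l = none ∧ c.var ∈ M.accepting

end NondetTM

/-- The problem of deciding `P a` for an instance `a`, given as the bit string `enc a`, is in
`NTIME(t)`: some nondeterministic machine has an accepting computation on `enc a` iff `P a` holds,
and then one with at most `t (enc a).length` steps. If every string is the encoding of an
instance, this is membership of a language in `NTIME(t)`. -/
def InNTIME {α : Type} (enc : α → List Bool) (P : α → Prop) (t : ℕ → ℕ) : Prop :=
  ∃ M : NondetTM, ∀ a : α,
    (P a → ∃ n ≤ t (enc a).length, M.AcceptsIn (enc a) n) ∧
    (∀ n, M.AcceptsIn (enc a) n → P a)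

/-- `NEXPTIME` is the union of the classes `NTIME(2 ^ q(n))` over all polynomials `q`. -/
def InNEXPTIME {α : Type} (enc : α → List Bool) (P : α → Prop) : Prop :=
  ∃ q : Polynomial ℕ, InNTIME enc P fun n => 2 ^ q.eval n

/-! ### Presentations of classes of transformer encoders -/

/-- Words as bit strings: each symbol is written in unary and followed by a terminating `false`. -/
def wordCode (w : List ℕ) : List Bool :=
  w.flatMap fun n => List.replicate n true ++ [false]

/-- The pair of a representation of an encoder and a word, as a string over `Bool ⊕ Bool`. -/
def pairCode {ι : Type} (enc : ι → List Bool) (z : ι × List ℕ) : List (Bool ⊕ Bool) :=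
  (enc z.1).map Sum.inl ++ (wordCode z.2).map Sum.inr

open Classical in
/-- The polynomial evaluation property: some deterministic Turing machine decides whether
`T(w) = 1`, given (the representation of) `T` and `w`, in polynomial time. -/
def PolynomialEvaluation {ι : Type} (enc : ι → List Bool) (F : ι → FixedWidthArithmetic)
    (T : ∀ i, TransformerEncoder (F i)) : Prop :=
  Nonempty (Turing.TM2ComputableInPolyTime (pairCode enc) Computability.encodeBool
    fun z => decide ((T z.1).AcceptsNat z.2))

/-! A satisfiable encoder accepts some word of at most exponential length; such a word is guessed
and then evaluated.

For the length bound, let the type of a position be its symbol together with the position modulo the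
period. Equal types carry equal vectors in every layer (`hidden_eq_map_values`), and the word
influences these vectors only through the set of its types and finitely many sums over its
positions: softmax denominators, hardmax counts and pooled components, for each layer, head and
query type. Sums are accumulated from left to right in a finite set, so the length modulo the
period, the types seen and the partial sums form the state of a finite automaton. The summands
depend on the whole word, hence they are frozen at their values for the original word. If two proper
prefixes have equal states, cutting out the segment between them preserves all frozen sums, and
induction on the layers shows that the shorter word really has these summands (`values_congr`,
`output_cut`). No associativity of the rounded addition is needed. A shortest accepted word is thus
no longer than the number of states (`card_prefixState_le`).

The machine guesses a bit string below its input and simulates the evaluator. Every bit string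
ending in `false` codes a word (`exists_wordCode_eq`), so guesses need no syntax check. Soundness is
the invariant `Reachable`, completeness is `GuessAndCheck.acceptsIn`. -/

namespace FixedWidthArithmetic

variable {F : FixedWidthArithmetic}

theorem sum_append (l l' : List F.Val) : sum (l ++ l') = l'.foldl add (sum l) :=
  List.foldl_append

/-- The weights given by softmax depend only on the score of the position and on the sum of the
exponentials of all scores. -/
theorem softmax_congr {s s' : List F.Val} {k k' : ℕ}
    (hk : s.getD k zero = s'.getD k' zero) (hexp : sum (s.map exp) = sum (s'.map exp)) :
    F.softmax k s = F.softmax k' s' := by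
  simp only [softmax, hk, hexp]

/-- The weights given by hardmax depend only on the score of the position, on the set of all
scores and on the number of occurrences of this score, as counted by the arithmetic. -/
theorem hardmax_congr {s s' : List F.Val} {k k' : ℕ}
    (hk : s.getD k zero = s'.getD k' zero) (hmem : ∀ v, v ∈ s ↔ v ∈ s')
    (hcount : sum (s.map fun t => if t = s.getD k zero then (one : F.Val) else zero) =
      sum (s'.map fun t => if t = s.getD k zero then one else zero)) :
    F.hardmax k s = F.hardmax k' s' := by
  simp only [hardmax, ← hk, hmem, hcount]

end FixedWidthArithmetic

/-! ### Pooling as a function of finitely many sums -/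

section Pooling

open FixedWidthArithmetic

variable {F : FixedWidthArithmetic} {d : ℕ} {τ : Type} [DecidableEq τ]

/-- The summands of all the sums that are accumulated by an attention head querying from an element
of type `t` of a sequence `U` of types, where `g` gives the vectors belonging to the types: the
denominator of softmax, the numbers of occurrences of the scores, and the components of the pooled
vector. -/
noncomputable def AttentionHead.summand (a : AttentionHead F d) (g : τ → F.Vec d) (U : List τ)
    (t : τ) : Unit ⊕ τ ⊕ Fin a.outDim → τ → F.Val
  | .inl _, u => exp (a.score (g t) (g u))
  | .inr (.inl t'), u => if a.score (g t) (g u) = a.score (g t) (g t') then one else zero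
  | .inr (.inr c), u =>
    mul (a.norm (U.idxOf u) (U.map fun u => a.score (g t) (g u))) (mulVec a.W (g u) c)

variable {a : AttentionHead F d} {g : τ → F.Vec d} {U U' : List τ} {t : τ}

/-- Softmax reads only the score at the position and the denominator. Hardmax reads this score, the
set of scores, which is determined by the set of types, and the count of this score. The denominator
and the counts are among the sums in `hsum`. -/
theorem AttentionHead.norm_congr (ha : a.norm = F.softmax ∨ a.norm = F.hardmax)
    (hmem : ∀ u, u ∈ U' ↔ u ∈ U)
    (hsum : ∀ q, sum (U'.map (a.summand g U t q)) = sum (U.map (a.summand g U t q)))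
    {k k' : ℕ} (hk : k < U.length) (hk' : k' < U'.length) (hkk' : U'[k'] = U[k]) :
    a.norm k' (U'.map fun u => a.score (g t) (g u)) =
      a.norm k (U.map fun u => a.score (g t) (g u)) := by
  have hget : (U'.map fun u => a.score (g t) (g u)).getD k' zero =
      (U.map fun u => a.score (g t) (g u)).getD k zero := by
    simp [List.getD_eq_getElem?_getD, hk, hk', hkk']
  rcases ha with ha | ha <;> rw [ha]
  · refine softmax_congr hget ?_
    rw [List.map_map, List.map_map]
    exact hsum (.inl ())
  · refine hardmax_congr hget (fun v => by simp [hmem]) ?_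
    rw [show (U'.map fun u => a.score (g t) (g u)).getD k' zero = a.score (g t) (g U[k]) by
      simp [List.getD_eq_getElem?_getD, hk', hkk'], List.map_map, List.map_map]
    -- Counts are indexed by a type having the score in question, here the type at `k`.
    exact hsum (.inr (.inl U[k]))

/-- `summand` evaluates the weight of a type at its first occurrence in `U`, which is legitimate
because the weight depends only on the type. Letting `U'` differ from `U` covers both sides of
`pool_congr`. -/
theorem AttentionHead.pool_eq_sum (ha : a.norm = F.softmax ∨ a.norm = F.hardmax)
    (hmem : ∀ u, u ∈ U' ↔ u ∈ U)
    (hsum : ∀ q, sum (U'.map (a.summand g U t q)) = sum (U.map (a.summand g U t q)))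
    (c : Fin a.outDim) :
    a.pool (U'.map g) ((U'.map g).map fun y => a.score (g t) y) c =
      sum (U'.map (a.summand g U t (.inr (.inr c)))) := by
  unfold AttentionHead.pool
  congr 1
  refine List.ext_getElem (by simp) fun k hk _ => ?_
  have hk' : k < U'.length := by simpa using hk
  have hU : U'[k] ∈ U := (hmem _).1 (List.getElem_mem hk')
  simp only [List.getElem_mapIdx, List.getElem_map, AttentionHead.summand, List.map_map,
    Function.comp_def]
  rw [AttentionHead.norm_congr ha hmem hsum (List.idxOf_lt_length_iff.2 hU) hk' (by simp)]

/-- Two sequences of types with the same elements on which all sums agree have the same pooled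
vectors. -/
theorem AttentionHead.pool_congr (ha : a.norm = F.softmax ∨ a.norm = F.hardmax)
    (hmem : ∀ u, u ∈ U' ↔ u ∈ U)
    (hsum : ∀ q, sum (U'.map (a.summand g U t q)) = sum (U.map (a.summand g U t q))) :
    a.pool (U'.map g) ((U'.map g).map fun y => a.score (g t) y) =
      a.pool (U.map g) ((U.map g).map fun y => a.score (g t) y) := by
  funext c
  rw [AttentionHead.pool_eq_sum ha hmem hsum, hsum,
    AttentionHead.pool_eq_sum ha (fun _ => Iff.rfl) (fun _ => rfl)]

end Pooling

/-! ### Types of positions, prefix states and cutting -/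

namespace TransformerEncoder

open FixedWidthArithmetic

variable {F : FixedWidthArithmetic} (T : TransformerEncoder F)

/-- The type of a position: its symbol and the position modulo the period. -/
abbrev PosType (p : ℕ) : Type := Fin T.numSymbols × Fin p

/-- The types of the positions of a word. -/
def typeWord (p : ℕ) [NeZero p] (w : List (Fin T.numSymbols)) : List (T.PosType p) :=
  w.mapIdx fun m a => (a, Fin.ofNat p (m + 1))

variable {p : ℕ}

/-- The vector computed by the first `i` layers for positions of a given type, in a sequence `U` of
types, where `g` is the embedding. -/
noncomputable def values (g : T.PosType p → F.Vec (T.dim 0)) (U : List (T.PosType p)) :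
    (i : ℕ) → i ≤ T.depth → T.PosType p → F.Vec (T.dim i)
  | 0, _ => g
  | i + 1, h => fun t =>
    let X := U.map (values g U i (Nat.le_of_succ_le h))
    let x := values g U i (Nat.le_of_succ_le h) t
    (T.layer ⟨i, h⟩).comb x fun j =>
      ((T.layer ⟨i, h⟩).head j).pool X (X.map fun y => ((T.layer ⟨i, h⟩).head j).score x y)

/-- Positions of the same type carry the same vectors. -/
theorem hidden_eq_map_values [NeZero p] {g : T.PosType p → F.Vec (T.dim 0)}
    (hg : ∀ a m, T.emb a m = g (a, Fin.ofNat p m)) (w : List (Fin T.numSymbols)) :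
    ∀ (i : ℕ) (h : i ≤ T.depth),
      T.hidden w i h = (T.typeWord p w).map (T.values g (T.typeWord p w) i h)
  | 0, _ => by
    simp only [hidden, values, typeWord, hg]
    exact List.ext_getElem (by simp) fun k _ _ => by simp
  | i + 1, h => by
    simp only [hidden, values, EncoderLayer.apply,
      hidden_eq_map_values hg w i (Nat.le_of_succ_le h), List.map_map, Function.comp_def]

/-- The indices of all the sums that are accumulated in a computation. -/
abbrev SumIndex (p : ℕ) : Type :=
  Σ i : Fin T.depth, Σ j : Fin (T.layer i).numHeads,
    T.PosType p × (Unit ⊕ T.PosType p ⊕ Fin ((T.layer i).head j).outDim)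

instance : DecidableEq (T.SumIndex p) := inferInstance

instance : Fintype (T.SumIndex p) := inferInstance

instance : Fintype (T.SumIndex p → F.Val) := inferInstance

/-- The summands of the sum with a given index. -/
noncomputable def summand (g : T.PosType p → F.Vec (T.dim 0)) (U : List (T.PosType p))
    (q : T.SumIndex p) : T.PosType p → F.Val :=
  ((T.layer q.1).head q.2.1).summand (T.values g U q.1 q.1.2.le) U q.2.2.1 q.2.2.2

variable {T}

/-- Both sides of `hsum` use summands frozen for `U`, so nothing is presupposed about the values for
`U'`. Once the two agree after `i` layers, the sums formed by the next layer are exactly those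
controlled by `hsum`. -/
theorem values_congr (hnorm : T.SoftmaxOrHardmax) {g : T.PosType p → F.Vec (T.dim 0)}
    {U U' : List (T.PosType p)} (hmem : ∀ u, u ∈ U' ↔ u ∈ U)
    (hsum : ∀ q, sum (U'.map (T.summand g U q)) = sum (U.map (T.summand g U q))) :
    ∀ (i : ℕ) (h : i ≤ T.depth), T.values g U' i h = T.values g U i h
  | 0, _ => rfl
  | i + 1, h => by
    funext t
    simp only [values, values_congr hnorm hmem hsum i (Nat.le_of_succ_le h)]
    congr 1
    funext j
    exact AttentionHead.pool_congr (hnorm _ _) hmem fun q => hsum ⟨⟨i, h⟩, j, t, q⟩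

/-- What has to be remembered of a prefix of a word: its length modulo the period, the types of its
positions and the partial sums. -/
abbrev PrefixState (T : TransformerEncoder F) (p : ℕ) : Type :=
  Fin p × Finset (T.PosType p) × (T.SumIndex p → F.Val)

/-- The state after `n` symbols of a word. -/
noncomputable def prefixState [NeZero p] (g : T.PosType p → F.Vec (T.dim 0))
    (U : List (T.PosType p)) (n : ℕ) : T.PrefixState p :=
  (Fin.ofNat p n, (U.take n).toFinset, fun q => sum ((U.take n).map (T.summand g U q)))

/-- The suffix moves from offset `n` to offset `m`, which are congruent modulo the period. -/
theorem typeWord_cut [NeZero p] (w : List (Fin T.numSymbols)) {m n : ℕ} (hm : m ≤ w.length)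
    (hmn : Fin.ofNat p m = Fin.ofNat p n) :
    T.typeWord p (w.take m ++ w.drop n) = (T.typeWord p w).take m ++ (T.typeWord p w).drop n := by
  unfold typeWord
  rw [List.mapIdx_append]
  congr 1
  · refine List.ext_getElem (by simp) fun k _ _ => by simp
  · refine List.ext_getElem (by simp) fun k _ _ => ?_
    simp only [List.getElem_mapIdx, List.getElem_drop, List.length_take, min_eq_left hm,
      Prod.mk.injEq, true_and]
    have : m % p = n % p := by simpa [Fin.ofNat, Fin.ext_iff] using hmn
    simp only [Fin.ofNat, Fin.mk.injEq]
    exact Nat.ModEq.add_right 1 ((Nat.ModEq.add_left k this).trans (by rw [add_comm k n]))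

theorem output_eq [NeZero p] {g : T.PosType p → F.Vec (T.dim 0)}
    (hg : ∀ a m, T.emb a m = g (a, Fin.ofNat p m)) (w : List (Fin T.numSymbols)) :
    T.output w = (T.typeWord p w).getLast?.map
      fun t => T.out (T.values g (T.typeWord p w) T.depth le_rfl t) := by
  rw [output, T.hidden_eq_map_values hg, List.getLast?_map, Option.map_map]
  rfl

/-- The part of a word between two equal states can be cut out. -/
theorem output_cut [NeZero p] (hnorm : T.SoftmaxOrHardmax) {g : T.PosType p → F.Vec (T.dim 0)}
    (hg : ∀ a m, T.emb a m = g (a, Fin.ofNat p m)) (w : List (Fin T.numSymbols)) {m n : ℕ}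
    (hm : m < w.length) (hn : n < w.length)
    (h : prefixState g (T.typeWord p w) m = prefixState g (T.typeWord p w) n) :
    T.output (w.take m ++ w.drop n) = T.output w := by
  simp only [prefixState, Prod.mk.injEq] at h
  obtain ⟨hmod, hset, hpart⟩ := h
  have hcut := typeWord_cut (T := T) w hm.le hmod
  set U := T.typeWord p w with hU
  have hlen : U.length = w.length := by simp [hU, typeWord]
  have hvalues := values_congr hnorm (g := g) (U := U) (U' := U.take m ++ U.drop n)
    (fun u => by
      rw [List.mem_append, ← List.mem_toFinset, hset, List.mem_toFinset, ← List.mem_append,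
        List.take_append_drop])
    -- A sum accumulated from the left is determined by its partial sum at the cut and the remaining
    -- summands.
    (fun q => by
      rw [List.map_append, sum_append, congrFun hpart q, ← sum_append, ← List.map_append,
        List.take_append_drop])
    T.depth le_rfl
  -- As `n < w.length`, the suffix is non-empty and the last type survives the cut.
  rw [output_eq hg, output_eq hg, hcut, ← hU, hvalues, List.getLast?_append_of_ne_nil _ (by
    rw [ne_eq, List.drop_eq_nil_iff]; omega), List.getLast?_drop, if_neg (by omega)]

/-- A satisfiable encoder accepts a word that is no longer than the number of states. -/
theorem exists_accepts_length_le [NeZero p] (hnorm : T.SoftmaxOrHardmax)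
    {g : T.PosType p → F.Vec (T.dim 0)} (hg : ∀ a m, T.emb a m = g (a, Fin.ofNat p m))
    (hsat : T.Satisfiable) :
    ∃ w, T.Accepts w ∧ w.length ≤ Fintype.card (T.PrefixState p) := by
  classical
  have hex : ∃ n, ∃ w, T.Accepts w ∧ w.length = n := by
    obtain ⟨w, _, hw⟩ := hsat
    exact ⟨_, w, hw, rfl⟩
  obtain ⟨w, hw, hlen⟩ := Nat.find_spec hex
  refine ⟨w, hw, ?_⟩
  by_contra! hlt
  obtain ⟨m, n, hne, heq⟩ := Fintype.exists_ne_map_eq_of_card_lt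
    (fun k : Fin w.length => prefixState g (T.typeWord p w) k) (by rwa [Fintype.card_fin])
  wlog hmn : m < n generalizing m n
  · exact this n m hne.symm heq.symm (lt_of_le_of_ne (not_lt.1 hmn) hne.symm)
  refine Nat.find_min hex (m := (w.take m ++ w.drop n).length) ?_ ⟨_, ?_, rfl⟩
  · have hm := m.2
    have hn := n.2
    simp only [List.length_append, List.length_take, List.length_drop]
    rw [← hlen]
    have : (m : ℕ) < n := hmn
    omega
  · simpa only [Accepts, output_cut hnorm hg w m.2 n.2 heq] using hw

theorem AdditivePeriodicalWith.exists_embedding [NeZero p] (h : T.AdditivePeriodicalWith p) :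
    ∃ g : T.PosType p → F.Vec (T.dim 0), ∀ a m, T.emb a m = g (a, Fin.ofNat p m) := by
  obtain ⟨_, emb', pos, hpos, hemb⟩ := h
  -- Position `0` does not occur in words, but represents the multiples of `p`, since `pos` is
  -- periodic from `0` on.
  refine ⟨fun t => T.emb t.1 t.2, fun a m => ?_⟩
  change T.emb a m = T.emb a (m % p)
  rw [hemb, hemb]
  have : pos (m % p) = pos m := Function.Periodic.map_mod_nat hpos m
  simp only [this]

/-! ### Counting states -/

/-- A polynomial bounding the logarithm of the number of states in the complexity. -/
noncomputable def stateBound : Polynomial ℕ :=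
  -- The terms account for the residue, the set of types and the partial sums. In the last one, `X ^
  -- 5` stands for layers, heads, query types (two factors) and bits, the bracket for the sums per
  -- head and query type.
  .X + .X ^ 2 + .X ^ 5 * (1 + .X ^ 2 + .X)

theorem card_prefixState_le (T : TransformerEncoder F) :
    Fintype.card (T.PrefixState T.period) ≤ 2 ^ stateBound.eval T.complexity := by
  set N := T.complexity with hN
  have hS : T.numSymbols ≤ N := by unfold complexity at hN; omega
  have hL : T.depth ≤ N := by unfold complexity at hN; omega
  have hH : T.width ≤ N := by unfold complexity at hN; omega
  have hD : T.dimensionality ≤ N := by unfold complexity at hN; omega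
  have hp : T.period ≤ N := by unfold complexity at hN; omega
  have hb : F.bits ≤ N := by unfold complexity at hN; omega
  have hτ : T.numSymbols * T.period ≤ N ^ 2 := by
    rw [sq]; exact Nat.mul_le_mul hS hp
  have hQ : Fintype.card (T.SumIndex T.period) ≤ N * (N * (N ^ 2 * (1 + (N ^ 2 + N)))) := by
    rw [Fintype.card_sigma]
    refine (Finset.sum_le_card_nsmul _ _ (N * (N ^ 2 * (1 + (N ^ 2 + N)))) fun i _ => ?_).trans ?_
    · rw [Fintype.card_sigma]
      refine (Finset.sum_le_card_nsmul _ _ (N ^ 2 * (1 + (N ^ 2 + N))) fun j _ => ?_).trans ?_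
      · have hc : ((T.layer i).head j).outDim ≤ N := by
          refine le_trans ?_ hD
          refine le_trans ?_ (le_max_right _ _)
          refine le_trans ?_ (Finset.le_sup (Finset.mem_univ i))
          exact Finset.le_sup (f := fun j => ((T.layer i).head j).outDim) (Finset.mem_univ j)
        simp only [Fintype.card_prod, Fintype.card_sum, Fintype.card_fin, Fintype.card_unit]
        gcongr
      · have : (T.layer i).numHeads ≤ N :=
          (Finset.le_sup (f := fun i => (T.layer i).numHeads) (Finset.mem_univ i)).trans hH
        simp only [Finset.card_univ, Fintype.card_fin, smul_eq_mul]
        gcongr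
    · simp only [Finset.card_univ, Fintype.card_fin, smul_eq_mul]
      gcongr
  have hV : Fintype.card F.Val ≤ 2 ^ N := by
    rw [Fintype.card_coe]
    exact F.card_values_le.trans (Nat.pow_le_pow_right two_pos hb)
  simp only [Fintype.card_prod, Fintype.card_fin, Fintype.card_finset, Fintype.card_fun]
  calc T.period * (2 ^ (T.numSymbols * T.period) *
        Fintype.card F.Val ^ Fintype.card (T.SumIndex T.period))
      ≤ 2 ^ N * (2 ^ N ^ 2 * (2 ^ N) ^ (N * (N * (N ^ 2 * (1 + (N ^ 2 + N)))))) := by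
        gcongr
        · exact hp.trans Nat.lt_two_pow_self.le
        · norm_num
        · exact Nat.one_le_two_pow
    _ = 2 ^ stateBound.eval N := by
        rw [← pow_mul, ← pow_add, ← pow_add]
        congr 1
        simp only [stateBound, Polynomial.eval_add, Polynomial.eval_mul, Polynomial.eval_pow,
          Polynomial.eval_X, Polynomial.eval_one]
        ring

/-- A satisfiable encoder accepts a word of exponential length. -/
theorem Satisfiable.exists_short (hnorm : T.SoftmaxOrHardmax) (hper : T.AdditivePeriodical)
    (hsat : T.Satisfiable) :
    ∃ w, T.Accepts w ∧ w.length ≤ 2 ^ stateBound.eval T.complexity := by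
  have hp : T.AdditivePeriodicalWith T.period :=
    Nat.sInf_mem (s := {p | T.AdditivePeriodicalWith p}) hper
  have : NeZero T.period := ⟨Nat.one_le_iff_ne_zero.1 hp.1⟩
  obtain ⟨g, hg⟩ := hp.exists_embedding
  obtain ⟨w, hw, hlen⟩ := exists_accepts_length_le hnorm hg hsat
  exact ⟨w, hw, hlen.trans T.card_prefixState_le⟩

end TransformerEncoder

/-! ### Guessing a certificate and running a deterministic verifier on it -/

namespace NondetTM

section Relations

variable {M : NondetTM}

theorem ReachesIn.trans {m n : ℕ} {c d e : M.tm.Cfg} (h : M.ReachesIn m c d)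
    (h' : M.ReachesIn n d e) : M.ReachesIn (m + n) c e := by
  induction m generalizing c with
  | zero => cases h; simpa using h'
  | succ m ih =>
    obtain ⟨c', hc, hd⟩ := h
    rw [Nat.add_right_comm]
    exact ⟨c', hc, ih hd⟩

theorem ReachesIn.single {c d : M.tm.Cfg} (h : M.Step c d) : M.ReachesIn 1 c d :=
  ⟨d, h, rfl⟩

theorem ReachesIn.invariant {I : M.tm.Cfg → Prop} (hI : ∀ c d, I c → M.Step c d → I d) {n : ℕ}
    {c d : M.tm.Cfg} (h : M.ReachesIn n c d) (hc : I c) : I d := by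
  induction n generalizing c with
  | zero => cases h; exact hc
  | succ n ih =>
    obtain ⟨c', hs, hd⟩ := h
    exact ih hd (hI _ _ hc hs)

end Relations

end NondetTM

namespace GuessAndCheck

open Turing

/-- The labels of a machine that guesses a certificate and runs a verifier with labels `Λ`. -/
inductive Label (Λ : Type)
  /-- move the input to the auxiliary stack -/
  | unload
  /-- extend the certificate or stop guessing -/
  | guess
  /-- guess the next bit of the certificate -/
  | guessBit
  /-- move the input to the input stack of the verifier -/
  | reload
  /-- run the verifier -/
  | run (l : Λ)
  /-- read the output of the verifier -/
  | finish
  deriving Fintype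

/-- The alphabets of the stacks: those of the verifier, the input stack and an auxiliary one. -/
abbrev Alphabet {K : Type} (Γ : K → Type) : K ⊕ Bool → Type :=
  Sum.elim Γ fun _ => Bool

/-! ### Simulating the verifier with additional stacks -/

section Translation

variable {K Λ σ : Type} {Γ : K → Type}

/-- A statement of the verifier as a statement of the guessing machine. -/
def translate : TM2.Stmt Γ Λ σ → TM2.Stmt (Alphabet Γ) (Label Λ) (σ × Option Bool)
  | .push k f q => .push (.inl k) (fun v => f v.1) (translate q)
  | .peek k f q => .peek (.inl k) (fun v a => (f v.1 a, v.2)) (translate q)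
  | .pop k f q => .pop (.inl k) (fun v a => (f v.1 a, v.2)) (translate q)
  | .load a q => .load (fun v => (a v.1, v.2)) (translate q)
  | .branch f q₁ q₂ => .branch (fun v => f v.1) (translate q₁) (translate q₂)
  | .goto l => .goto fun v => .run (l v.1)
  | .halt => .goto fun _ => .finish

/-- The stacks of the guessing machine. -/
def allStacks (inp aux : List Bool) (S : ∀ k, List (Γ k)) : ∀ k, List (Alphabet Γ k)
  | .inl k => S k
  | .inr false => inp
  | .inr true => aux

/-- The label that corresponds to a label of the verifier. -/
def runLabel : Option Λ → Label Λ
  | some l => .run l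
  | none => .finish

variable [DecidableEq K]

theorem update_allStacks_inl (inp aux : List Bool) (S : ∀ k, List (Γ k)) (k : K) (l : List (Γ k)) :
    Function.update (allStacks inp aux S) (.inl k) l =
      allStacks inp aux (Function.update S k l) := by
  funext k'
  rcases k' with k' | b
  · by_cases h : k' = k
    · subst h
      exact (Function.update_self ..).trans (Function.update_self (f := S) ..).symm
    · exact (Function.update_of_ne (by simpa using h) ..).trans (Function.update_of_ne h ..).symm
  · cases b <;> exact Function.update_of_ne (by simp) ..

theorem update_allStacks_input (inp aux l : List Bool) (S : ∀ k, List (Γ k)) :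
    Function.update (allStacks inp aux S) (.inr false) l = allStacks l aux S := by
  funext k'
  rcases k' with k' | _ | _
  · exact Function.update_of_ne (by simp) ..
  · exact Function.update_self ..
  · exact Function.update_of_ne (by simp) ..

theorem update_allStacks_aux (inp aux l : List Bool) (S : ∀ k, List (Γ k)) :
    Function.update (allStacks inp aux S) (.inr true) l = allStacks inp l S := by
  funext k'
  rcases k' with k' | _ | _
  · exact Function.update_of_ne (by simp) ..
  · exact Function.update_of_ne (by simp) ..
  · exact Function.update_self ..

theorem stepAux_branch_of_eq_true {f : σ → Bool} {q₁ q₂ : TM2.Stmt Γ Λ σ} {v : σ}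
    {S : ∀ k, List (Γ k)} (h : f v = true) :
    TM2.stepAux (.branch f q₁ q₂) v S = TM2.stepAux q₁ v S := by
  rw [TM2.stepAux, h, cond_true]

theorem stepAux_branch_of_eq_false {f : σ → Bool} {q₁ q₂ : TM2.Stmt Γ Λ σ} {v : σ}
    {S : ∀ k, List (Γ k)} (h : f v = false) :
    TM2.stepAux (.branch f q₁ q₂) v S = TM2.stepAux q₂ v S := by
  rw [TM2.stepAux, h, cond_false]

theorem stepAux_push_inl (inp aux : List Bool) (S : ∀ k, List (Γ k)) (k : K) {Λ' σ' : Type}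
    (f : σ' → Γ k) (q : TM2.Stmt (Alphabet Γ) Λ' σ') (v : σ') :
    TM2.stepAux (.push (.inl k) f q) v (allStacks inp aux S) =
      TM2.stepAux q v (allStacks inp aux (Function.update S k (f v :: S k))) :=
  congrArg (TM2.stepAux q v) (update_allStacks_inl ..)

theorem stepAux_pop_inl (inp aux : List Bool) (S : ∀ k, List (Γ k)) (k : K) {Λ' σ' : Type}
    (f : σ' → Option (Γ k) → σ') (q : TM2.Stmt (Alphabet Γ) Λ' σ') (v : σ') :
    TM2.stepAux (.pop (.inl k) f q) v (allStacks inp aux S) =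
      TM2.stepAux q (f v (S k).head?) (allStacks inp aux (Function.update S k (S k).tail)) :=
  congrArg (TM2.stepAux q _) (update_allStacks_inl ..)

theorem stepAux_pop_input (inp aux : List Bool) (S : ∀ k, List (Γ k)) {Λ' σ' : Type}
    (f : σ' → Option Bool → σ') (q : TM2.Stmt (Alphabet Γ) Λ' σ') (v : σ') :
    TM2.stepAux (.pop (.inr false) f q) v (allStacks inp aux S) =
      TM2.stepAux q (f v inp.head?) (allStacks inp.tail aux S) :=
  congrArg (TM2.stepAux q _) (update_allStacks_input ..)

theorem stepAux_push_aux (inp aux : List Bool) (S : ∀ k, List (Γ k)) {Λ' σ' : Type}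
    (f : σ' → Bool) (q : TM2.Stmt (Alphabet Γ) Λ' σ') (v : σ') :
    TM2.stepAux (.push (.inr true) f q) v (allStacks inp aux S) =
      TM2.stepAux q v (allStacks inp (f v :: aux) S) :=
  congrArg (TM2.stepAux q _) (update_allStacks_aux ..)

theorem stepAux_pop_aux (inp aux : List Bool) (S : ∀ k, List (Γ k)) {Λ' σ' : Type}
    (f : σ' → Option Bool → σ') (q : TM2.Stmt (Alphabet Γ) Λ' σ') (v : σ') :
    TM2.stepAux (.pop (.inr true) f q) v (allStacks inp aux S) =
      TM2.stepAux q (f v aux.head?) (allStacks inp aux.tail S) :=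
  congrArg (TM2.stepAux q _) (update_allStacks_aux ..)

/-- Translated code touches only the stacks of the verifier and the first component of the state.
Halting becomes a jump to `finish`, so there is always a next label. -/
theorem stepAux_translate (q : TM2.Stmt Γ Λ σ) (v : σ) (r : Option Bool) (inp aux : List Bool)
    (S : ∀ k, List (Γ k)) :
    TM2.stepAux (translate q) (v, r) (allStacks inp aux S) =
      ⟨some (runLabel (TM2.stepAux q v S).l), ((TM2.stepAux q v S).var, r),
        allStacks inp aux (TM2.stepAux q v S).stk⟩ := by
  induction q generalizing v S with
  | push k f q ih => exact (stepAux_push_inl ..).trans (ih _ _)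
  | peek k f q ih => exact ih _ _
  | pop k f q ih => exact (stepAux_pop_inl ..).trans (ih _ _)
  | load a q ih => exact ih _ _
  | branch f q₁ q₂ ih₁ ih₂ =>
    simp only [translate, TM2.stepAux]
    cases f v
    · exact ih₂ _ _
    · exact ih₁ _ _
  | goto l => rfl
  | halt => rfl

end Translation

/-! ### The guessing machine and its single steps -/

variable (V : TM2ComputableAux (Bool ⊕ Bool) Bool)

abbrev Stmt : Type :=
  TM2.Stmt (Alphabet V.tm.Γ) (Label V.tm.Λ) (V.tm.σ × Option Bool)

/-- Push a symbol on the input stack of the verifier. -/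
def pushInput (f : V.tm.σ × Option Bool → Bool ⊕ Bool) (q : Stmt V) : Stmt V :=
  .push (.inl V.tm.k₀) (fun v => V.inputAlphabet.symm (f v)) q

/-- The program of the guessing machine. The flag tells which of two programs this is. -/
def program (b : Bool) : Label V.tm.Λ → Stmt V
  -- The certificate must lie below the input, and each transfer reverses the input; hence the
  -- detour over the auxiliary stack.
  | .unload =>
    .pop (.inr false) (fun v a => (v.1, a)) <|
      .branch (fun v => v.2.isSome)
        (.push (.inr true) (fun v => v.2.getD false) <| .goto fun _ => .unload)
        -- This bottom symbol makes every guess end in `false`.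
        (pushInput V (fun _ => .inr false) <| .goto fun _ => .guess)
  -- The two programs differ only at `guess` and `guessBit`.
  | .guess => .goto fun _ => if b then .guessBit else .reload
  | .guessBit => pushInput V (fun _ => .inr b) <| .goto fun _ => .guess
  | .reload =>
    .pop (.inr true) (fun v a => (v.1, a)) <|
      .branch (fun v => v.2.isSome)
        (pushInput V (fun v => .inl (v.2.getD false)) <| .goto fun _ => .reload)
        (.goto fun _ => .run V.tm.main)
  | .run l => translate (V.tm.m l)
  | .finish => .pop (.inl V.tm.k₁) (fun v a => (v.1, a.map V.outputAlphabet)) .halt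

/-- The machine that guesses a certificate, puts it below the input, runs the verifier and accepts
if the output of the verifier is `true`. -/
def machine : NondetTM where
  tm :=
    { K := V.tm.K ⊕ Bool
      kDecidableEq := @instDecidableEqSum _ _ V.tm.kDecidableEq _
      kFin := @instFintypeSum _ _ V.tm.kFin _
      k₀ := .inr false
      k₁ := .inl V.tm.k₁
      Γ := Alphabet V.tm.Γ
      Λ := Label V.tm.Λ
      main := .unload
      ΛFin := @instFintypeLabel _ V.tm.ΛFin
      σ := V.tm.σ × Option Bool
      initialState := (V.tm.initialState, none)
      σFin := @instFintypeProd _ _ V.tm.σFin _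
      Γk₀Fin := inferInstanceAs (Fintype Bool)
      m := program V true }
  alt := program V false
  accepting := {v | v.2 = some true}
  inputAlphabet := Equiv.refl Bool

variable {V}

/-- A configuration of the guessing machine. -/
def cfg (l : Option (Label V.tm.Λ)) (v : V.tm.σ) (r : Option Bool) (inp aux : List Bool)
    (S : ∀ k, List (V.tm.Γ k)) : (machine V).tm.Cfg :=
  ⟨l, (v, r), allStacks inp aux S⟩

/-- The input stack of the verifier holds the given symbols, all other stacks are empty. -/
def verifierStacks (V : TM2ComputableAux (Bool ⊕ Bool) Bool) (z : List (Bool ⊕ Bool)) :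
    ∀ k, List (V.tm.Γ k) :=
  (initList V.tm (z.map V.inputAlphabet.symm)).stk

theorem verifierStacks_nil : verifierStacks V [] = fun _ => [] := by
  funext k
  by_cases h : k = V.tm.k₀
  · subst h; simp [verifierStacks, initList]
  · simp [verifierStacks, initList, h]

theorem update_verifierStacks (a : Bool ⊕ Bool) (z : List (Bool ⊕ Bool)) :
    Function.update (verifierStacks V z) V.tm.k₀
      (V.inputAlphabet.symm a :: verifierStacks V z V.tm.k₀) = verifierStacks V (a :: z) := by
  funext k
  by_cases h : k = V.tm.k₀
  · subst h; simp [verifierStacks, initList]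
  · simp [verifierStacks, initList, h]

theorem step_iff {c d : (machine V).tm.Cfg} :
    (machine V).Step c d ↔ ∃ b, TM2.step (program V b) c = some d := by
  simp only [NondetTM.Step, Bool.exists_bool]
  exact or_comm

theorem step_unload_cons (b x : Bool) (v r inp aux S) :
    TM2.step (program V b) (cfg (V := V) (some .unload) v r (x :: inp) aux S) =
      some (cfg (some .unload) v (some x) inp (x :: aux) S) :=
  congrArg some ((stepAux_pop_input ..).trans <|
    (stepAux_branch_of_eq_true rfl).trans (stepAux_push_aux ..))

theorem step_unload_nil (b : Bool) (v r aux) :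
    TM2.step (program V b) (cfg (V := V) (some .unload) v r [] aux (verifierStacks V [])) =
      some (cfg (some .guess) v none [] aux (verifierStacks V [.inr false])) := by
  rw [← update_verifierStacks]
  exact congrArg some ((stepAux_pop_input ..).trans <|
    (stepAux_branch_of_eq_false rfl).trans (stepAux_push_inl ..))

theorem step_guess (b : Bool) (v r inp aux S) :
    TM2.step (program V b) (cfg (V := V) (some .guess) v r inp aux S) =
      some (cfg (some (if b then .guessBit else .reload)) v r inp aux S) :=
  rfl

theorem step_guessBit (b : Bool) (v r inp aux z) :
    TM2.step (program V b) (cfg (V := V) (some .guessBit) v r inp aux (verifierStacks V z)) =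
      some (cfg (some .guess) v r inp aux (verifierStacks V (.inr b :: z))) := by
  rw [← update_verifierStacks]
  exact congrArg some (stepAux_push_inl ..)

theorem step_reload_cons (b x : Bool) (v r inp aux z) :
    TM2.step (program V b)
        (cfg (V := V) (some .reload) v r inp (x :: aux) (verifierStacks V z)) =
      some (cfg (some .reload) v (some x) inp aux (verifierStacks V (.inl x :: z))) := by
  rw [← update_verifierStacks]
  exact congrArg some ((stepAux_pop_aux ..).trans <|
    (stepAux_branch_of_eq_true rfl).trans (stepAux_push_inl ..))

theorem step_reload_nil (b : Bool) (v r inp S) :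
    TM2.step (program V b) (cfg (V := V) (some .reload) v r inp [] S) =
      some (cfg (some (.run V.tm.main)) v none inp [] S) :=
  congrArg some (stepAux_pop_aux ..)

theorem step_run (b : Bool) (r inp aux) {c c' : V.tm.Cfg} (h : V.tm.step c = some c') :
    TM2.step (program V b) (cfg (V := V) (some (runLabel c.l)) c.var r inp aux c.stk) =
      some (cfg (some (runLabel c'.l)) c'.var r inp aux c'.stk) := by
  obtain ⟨_ | l, v, S⟩ := c
  · cases h
  · cases h
    exact congrArg some (stepAux_translate _ _ _ _ _ _)

theorem step_finish (b : Bool) (v r inp aux S) :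
    TM2.step (program V b) (cfg (V := V) (some .finish) v r inp aux S) =
      some (cfg none v ((S V.tm.k₁).head?.map V.outputAlphabet) inp aux
        (Function.update S V.tm.k₁ (S V.tm.k₁).tail)) :=
  congrArg some (stepAux_pop_inl ..)

theorem initList_machine (x : List Bool) :
    initList (machine V).tm (x.map (machine V).inputAlphabet.symm) =
      cfg (some .unload) V.tm.initialState none x [] (verifierStacks V []) := by
  unfold initList cfg
  congr 1
  funext k
  rcases k with k | _ | _
  · exact (congrFun verifierStacks_nil k).symm
  · exact List.map_id x
  · rfl

/-! ### Runs of the verifier and soundness -/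

/-- The verifier reaches `c` from the input `z`. -/
def VerifierReaches (V : TM2ComputableAux (Bool ⊕ Bool) Bool) (z : List (Bool ⊕ Bool)) (n : ℕ)
    (c : V.tm.Cfg) : Prop :=
  (flip bind V.tm.step)^[n] (some (initList V.tm (z.map V.inputAlphabet.symm))) = some c

theorem VerifierReaches.succ {z : List (Bool ⊕ Bool)} {n : ℕ} {c c' : V.tm.Cfg}
    (h : VerifierReaches V z n c) (hc : V.tm.step c = some c') : VerifierReaches V z (n + 1) c' := by
  rw [VerifierReaches, Function.iterate_succ_apply', h]
  exact hc

theorem VerifierReaches.exists_of_succ {z : List (Bool ⊕ Bool)} {n : ℕ} {c' : V.tm.Cfg}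
    (h : VerifierReaches V z (n + 1) c') :
    ∃ c, VerifierReaches V z n c ∧ V.tm.step c = some c' := by
  rw [VerifierReaches, Function.iterate_succ_apply'] at h
  obtain ⟨c, hc, hc'⟩ := Option.bind_eq_some_iff.1 h
  exact ⟨c, hc, hc'⟩

/-- The verifier is deterministic and a halted configuration has no successor, so every later
iterate is `none`. -/
theorem VerifierReaches.eq_of_halted {z : List (Bool ⊕ Bool)} {m n : ℕ} {c d : V.tm.Cfg}
    (hc : VerifierReaches V z m c) (hd : VerifierReaches V z n d) (hcl : c.l = none)
    (hdl : d.l = none) : c = d := by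
  have halted : ∀ {c : V.tm.Cfg}, c.l = none → V.tm.step c = none := by
    rintro ⟨_ | l, v, S⟩ h
    · rfl
    · cases h
  have later : ∀ {c : V.tm.Cfg} {m : ℕ}, VerifierReaches V z m c → c.l = none →
      ∀ k (d : V.tm.Cfg), ¬ VerifierReaches V z (m + (k + 1)) d := by
    intro c m hc hcl k
    induction k with
    | zero =>
      intro d h
      obtain ⟨c', hc', hs⟩ := VerifierReaches.exists_of_succ h
      obtain rfl : c = c' := Option.some.inj (hc.symm.trans hc')
      rw [halted hcl] at hs
      cases hs
    | succ k ih =>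
      intro d h
      obtain ⟨c', hc', -⟩ := VerifierReaches.exists_of_succ h
      exact ih c' hc'
  rcases lt_trichotomy m n with h | rfl | h
  · obtain ⟨k, rfl⟩ := Nat.exists_eq_add_of_lt h
    exact absurd hd (later hc hcl k d)
  · exact Option.some.inj (hc.symm.trans hd)
  · obtain ⟨k, rfl⟩ := Nat.exists_eq_add_of_lt h
    exact absurd hc (later hd hdl k c)

/-- The input of the verifier for an input `x` and a guessed certificate. -/
def verifierInput (x u : List Bool) : List (Bool ⊕ Bool) :=
  x.map .inl ++ (u ++ [false]).map .inr

/-- The configurations that occur in computations of the machine on the input `x`. -/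
inductive Reachable (V : TM2ComputableAux (Bool ⊕ Bool) Bool) (x : List Bool) :
    (machine V).tm.Cfg → Prop
  | unload {done rest : List Bool} (r : Option Bool) (h : done.reverse ++ rest = x) :
    Reachable V x (cfg (some .unload) V.tm.initialState r rest done (verifierStacks V []))
  | guess (u : List Bool) (r : Option Bool) :
    Reachable V x
      (cfg (some .guess) V.tm.initialState r [] x.reverse (verifierStacks V (verifierInput [] u)))
  | guessBit (u : List Bool) (r : Option Bool) :
    Reachable V x (cfg (some .guessBit) V.tm.initialState r [] x.reverse
      (verifierStacks V (verifierInput [] u)))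
  | reload {rest done : List Bool} (u : List Bool) (r : Option Bool) (h : rest.reverse ++ done = x) :
    Reachable V x
      (cfg (some .reload) V.tm.initialState r [] rest (verifierStacks V (verifierInput done u)))
  | run (u : List Bool) {n : ℕ} {c : V.tm.Cfg} (h : VerifierReaches V (verifierInput x u) n c) :
    Reachable V x (cfg (some (runLabel c.l)) c.var none [] [] c.stk)
  -- Acceptance ignores the final stacks, so `S` is arbitrary.
  | halted (u : List Bool) {n : ℕ} {c : V.tm.Cfg} (h : VerifierReaches V (verifierInput x u) n c)
    (hc : c.l = none) (S : ∀ k, List (V.tm.Γ k)) :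
    Reachable V x (cfg none c.var ((c.stk V.tm.k₁).head?.map V.outputAlphabet) [] [] S)

theorem Reachable.step {x : List Bool} {c d : (machine V).tm.Cfg} (hc : Reachable V x c)
    (hcd : (machine V).Step c d) : Reachable V x d := by
  obtain ⟨b, hb⟩ := step_iff.1 hcd
  clear hcd
  cases hc with
  | @unload done rest r h =>
    cases rest with
    | nil =>
      rw [step_unload_nil] at hb
      cases hb
      rw [List.append_nil] at h
      rw [← List.reverse_reverse done, h]
      exact .guess [] none
    | cons a rest =>
      rw [step_unload_cons] at hb
      cases hb
      exact .unload _ (by simpa using h)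
  | guess u r =>
    rw [step_guess] at hb
    cases hb
    cases b
    · exact .reload u r (by simp)
    · exact .guessBit u r
  | guessBit u r =>
    rw [step_guessBit] at hb
    cases hb
    -- The latest guess lies on top and is the first bit of the certificate.
    exact .guess (b :: u) r
  | @reload rest done u r h =>
    cases rest with
    | nil =>
      rw [step_reload_nil] at hb
      cases hb
      obtain rfl : done = x := h
      -- The verifier's component of the state has not changed so far, so this is the verifier's
      -- initial configuration.
      exact .run u (n := 0) rfl
    | cons a rest =>
      rw [step_reload_cons] at hb
      cases hb
      exact .reload (done := a :: done) u (some a) (by simpa using h)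
  | @run u n c h =>
    cases hl : c.l with
    | none =>
      rw [hl, runLabel, step_finish] at hb
      cases hb
      exact .halted u h hl _
    | some l =>
      obtain ⟨_, v, S⟩ := c
      cases hl
      rw [step_run b none [] [] (c := ⟨some l, v, S⟩) rfl] at hb
      cases hb
      exact .run u (h.succ rfl)
  | halted u h hc S => cases hb

/-- If the machine accepts then the verifier outputs `true` for some certificate. -/
theorem exists_of_acceptsIn {x : List Bool} {n : ℕ} (h : (machine V).AcceptsIn x n) :
    ∃ (u : List Bool) (m : ℕ) (c : V.tm.Cfg), VerifierReaches V (verifierInput x u) m c ∧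
      c.l = none ∧ (c.stk V.tm.k₁).head?.map V.outputAlphabet = some true := by
  obtain ⟨c, hreach, hl, hv⟩ := h
  have hr := hreach.invariant (fun _ _ => Reachable.step)
    (initList_machine (V := V) x ▸ Reachable.unload (x := x) none (by simp))
  cases hr with
  | halted u h hc S => exact ⟨u, _, _, h, hc, hv⟩
  | _ => cases hl

/-! ### Completeness: following a given certificate -/

theorem reachesIn_unload (x aux : List Bool) (v r) :
    ∃ r', (machine V).ReachesIn x.length (cfg (some .unload) v r x aux (verifierStacks V []))
      (cfg (some .unload) v r' [] (x.reverse ++ aux) (verifierStacks V [])) := by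
  induction x generalizing aux r with
  | nil => exact ⟨r, rfl⟩
  | cons a x ih =>
    obtain ⟨r', h⟩ := ih (a :: aux) (some a)
    exact ⟨r', _, step_iff.2 ⟨true, step_unload_cons ..⟩, by simpa using h⟩

/-- Each bit costs two steps, one to continue and one to choose it. The last bit of `u` is guessed
first. -/
theorem reachesIn_guess (u : List Bool) (v r aux z) :
    (machine V).ReachesIn (2 * u.length) (cfg (some .guess) v r [] aux (verifierStacks V z))
      (cfg (some .guess) v r [] aux (verifierStacks V (u.map .inr ++ z))) := by
  induction u with
  | nil => rfl
  | cons a u ih =>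
    refine ih.trans (m := 2 * u.length) (n := 2) ?_
    exact ⟨_, step_iff.2 ⟨true, step_guess ..⟩, _, step_iff.2 ⟨a, step_guessBit ..⟩, rfl⟩

theorem reachesIn_reload (x : List Bool) (v r z) :
    ∃ r', (machine V).ReachesIn x.length (cfg (some .reload) v r [] x (verifierStacks V z))
      (cfg (some .reload) v r' [] [] (verifierStacks V (x.reverse.map .inl ++ z))) := by
  induction x generalizing r z with
  | nil => exact ⟨r, rfl⟩
  | cons a x ih =>
    obtain ⟨r', h⟩ := ih (some a) (.inl a :: z)
    exact ⟨r', _, step_iff.2 ⟨true, step_reload_cons ..⟩, by simpa using h⟩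

theorem reachesIn_run {z : List (Bool ⊕ Bool)} {n : ℕ} {c : V.tm.Cfg}
    (h : VerifierReaches V z n c) :
    (machine V).ReachesIn n
      (cfg (some (.run V.tm.main)) V.tm.initialState none [] [] (verifierStacks V z))
      (cfg (some (runLabel c.l)) c.var none [] [] c.stk) := by
  induction n generalizing c with
  | zero => cases h; rfl
  | succ n ih =>
    obtain ⟨c', hc', hs⟩ := h.exists_of_succ
    exact (ih hc').trans (.single (step_iff.2 ⟨true, step_run _ _ _ _ hs⟩))

/-- If the verifier outputs `true` for some certificate then the machine accepts. -/
theorem acceptsIn {x u : List Bool} {n : ℕ} {c : V.tm.Cfg}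
    (h : VerifierReaches V (verifierInput x u) n c) (hl : c.l = none)
    (hc : (c.stk V.tm.k₁).head?.map V.outputAlphabet = some true) :
    (machine V).AcceptsIn x (x.length + (1 + (2 * u.length + (1 + (x.length + (1 + (n + 1))))))) := by
  obtain ⟨r, h₁⟩ := reachesIn_unload (V := V) x [] V.tm.initialState none
  obtain ⟨r', h₂⟩ := reachesIn_reload (V := V) x.reverse V.tm.initialState none
    (u.map .inr ++ [.inr false])
  have hrun := reachesIn_run h
  rw [hl] at hrun
  rw [List.length_reverse] at h₂
  refine ⟨cfg none c.var (some true) [] [] (Function.update c.stk V.tm.k₁ (c.stk V.tm.k₁).tail),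
    ?_, rfl, rfl⟩
  rw [initList_machine]
  refine h₁.trans ?_
  refine (NondetTM.ReachesIn.single (step_iff.2 ⟨true, step_unload_nil ..⟩)).trans ?_
  refine (reachesIn_guess u ..).trans ?_
  -- The second program ends the guessing.
  refine (NondetTM.ReachesIn.single (step_iff.2 ⟨false, step_guess ..⟩)).trans ?_
  rw [List.append_nil]
  refine h₂.trans ?_
  refine (NondetTM.ReachesIn.single (step_iff.2 ⟨true, step_reload_nil ..⟩)).trans ?_
  rw [List.reverse_reverse]
  have hz : x.map Sum.inl ++ (u.map Sum.inr ++ [.inr false]) = verifierInput x u := by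
    simp [verifierInput]
  rw [hz]
  refine hrun.trans (.single (step_iff.2 ⟨true, ?_⟩))
  rw [runLabel, step_finish, hc]

end GuessAndCheck

/-! ### Exponentially bounded functions -/

/-- `f` is bounded by `2 ^ q` for a polynomial `q`. -/
def IsExpBounded (f : ℕ → ℕ) : Prop := ∃ q : Polynomial ℕ, ∀ n, f n ≤ 2 ^ q.eval n

namespace IsExpBounded

variable {f g : ℕ → ℕ}

theorem two_pow (q : Polynomial ℕ) : IsExpBounded fun n => 2 ^ q.eval n := ⟨q, fun _ => le_rfl⟩

theorem eval (q : Polynomial ℕ) : IsExpBounded fun n => q.eval n :=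
  ⟨q, fun _ => Nat.lt_two_pow_self.le⟩

theorem const (c : ℕ) : IsExpBounded fun _ => c := by
  simpa using eval (Polynomial.C c)

theorem id : IsExpBounded fun n => n := by
  simpa using eval Polynomial.X

theorem mul (hf : IsExpBounded f) (hg : IsExpBounded g) : IsExpBounded fun n => f n * g n := by
  obtain ⟨p, hp⟩ := hf
  obtain ⟨q, hq⟩ := hg
  refine ⟨p + q, fun n => ?_⟩
  rw [Polynomial.eval_add, pow_add]
  exact Nat.mul_le_mul (hp n) (hq n)

theorem add (hf : IsExpBounded f) (hg : IsExpBounded g) : IsExpBounded fun n => f n + g n := by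
  obtain ⟨p, hp⟩ := hf
  obtain ⟨q, hq⟩ := hg
  refine ⟨p + q + 1, fun n => ?_⟩
  simp only [Polynomial.eval_add, Polynomial.eval_one]
  have h₁ : 2 ^ p.eval n ≤ 2 ^ (p.eval n + q.eval n) :=
    Nat.pow_le_pow_right two_pos (Nat.le_add_right _ _)
  have h₂ : 2 ^ q.eval n ≤ 2 ^ (p.eval n + q.eval n) :=
    Nat.pow_le_pow_right two_pos (Nat.le_add_left _ _)
  have := hp n
  have := hq n
  rw [pow_succ]
  omega

theorem pow (hf : IsExpBounded f) : ∀ k : ℕ, IsExpBounded fun n => f n ^ k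
  | 0 => by simpa using const 1
  | k + 1 => by simpa only [pow_succ] using (pow hf k).mul hf

/-- Polynomial time on an exponentially long input is exponential time. -/
theorem comp (hf : IsExpBounded f) (p : Polynomial ℕ) : IsExpBounded fun n => p.eval (f n) := by
  induction p using Polynomial.induction_on' with
  | add p q hp hq => simpa only [Polynomial.eval_add] using hp.add hq
  | monomial k c => simpa only [Polynomial.eval_monomial] using (const c).mul (hf.pow k)

end IsExpBounded

theorem Polynomial.eval_mono_nat (p : Polynomial ℕ) {m n : ℕ} (h : m ≤ n) : p.eval m ≤ p.eval n := by
  simp only [Polynomial.eval_eq_sum, Polynomial.sum]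
  exact Finset.sum_le_sum fun k _ => Nat.mul_le_mul_left _ (Nat.pow_le_pow_left h k)

/-! ### Codes of words -/

/-- A leading `false` is a new symbol `0`; a leading `true` increments the first symbol. -/
theorem exists_wordCode_eq (u : List Bool) : ∃ w, wordCode w = u ++ [false] := by
  induction u with
  | nil => exact ⟨[0], rfl⟩
  | cons b u ih =>
    obtain ⟨w, hw⟩ := ih
    cases b with
    | false => exact ⟨0 :: w, by rw [List.cons_append, ← hw]; rfl⟩
    | true =>
      cases w with
      | nil => simp [wordCode] at hw
      | cons n w => exact ⟨(n + 1) :: w, by rw [List.cons_append, ← hw]; rfl⟩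

theorem exists_eq_wordCode {w : List ℕ} (hw : w ≠ []) : ∃ u, wordCode w = u ++ [false] := by
  obtain ⟨l, n, rfl⟩ := (List.eq_nil_or_concat w).resolve_left hw
  exact ⟨wordCode l ++ List.replicate n true, by simp [wordCode]⟩

theorem length_wordCode_le {w : List ℕ} {s : ℕ} (hw : ∀ a ∈ w, a < s) :
    (wordCode w).length ≤ w.length * s := by
  induction w with
  | nil => simp [wordCode]
  | cons a w ih =>
    have h₁ := ih fun b hb => hw b (List.mem_cons_of_mem _ hb)
    have h₂ := hw a List.mem_cons_self
    simp only [wordCode, List.flatMap_cons, List.length_append, List.length_replicate,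
      List.length_cons, List.length_nil, Nat.succ_mul] at h₁ ⊢
    omega

theorem TransformerEncoder.hidden_nil {F : FixedWidthArithmetic} (T : TransformerEncoder F) :
    ∀ (i : ℕ) (h : i ≤ T.depth), T.hidden [] i h = []
  | 0, _ => rfl
  | i + 1, h => by
    rw [hidden, hidden_nil T i (Nat.le_of_succ_le h)]
    rfl

theorem TransformerEncoder.Accepts.ne_nil {F : FixedWidthArithmetic} {T : TransformerEncoder F}
    {w : List (Fin T.numSymbols)} (h : T.Accepts w) : w ≠ [] := by
  rintro rfl
  obtain ⟨v, hv, -⟩ := h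
  simp [output, hidden_nil] at hv

theorem pairCode_eq_verifierInput {ι : Type} {enc : ι → List Bool} {i : ι} {w : List ℕ}
    {u : List Bool} (h : wordCode w = u ++ [false]) :
    pairCode enc (i, w) = GuessAndCheck.verifierInput (enc i) u := by
  simp only [pairCode, GuessAndCheck.verifierInput, h]

section Verifier

open GuessAndCheck Turing

/-- A machine that computes a Boolean function in polynomial time halts with the value on top of
its output stack. -/
theorem Turing.TM2ComputableInPolyTime.verifierReaches {α : Type} {ea : α → List (Bool ⊕ Bool)}
    {f : α → Bool} (V : TM2ComputableInPolyTime ea Computability.encodeBool f) (a : α) :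
    ∃ (n : ℕ) (c : V.tm.Cfg), n ≤ V.time.eval (ea a).length ∧
      VerifierReaches V.toTM2ComputableAux (ea a) n c ∧ c.l = none ∧
      (c.stk V.tm.k₁).head?.map V.outputAlphabet = some (f a) := by
  have h := V.outputsFun a
  refine ⟨h.steps, _, h.steps_le_m, h.evals_in_steps, rfl, ?_⟩
  simp [haltList, Computability.encodeBool]

end Verifier
-- The bound on nondeterministic time
theorem theorem4 {ι : Type} (enc : ι → List Bool)
    (F : ι → FixedWidthArithmetic) (T : ∀ i, TransformerEncoder (F i))
    (hperiodical : ∀ i, (T i).AdditivePeriodical)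
    (hnorm : ∀ i, (T i).SoftmaxOrHardmax)
    (hsize : ∃ q : Polynomial ℕ, ∀ i, (T i).complexity ≤ q.eval (enc i).length)
    (heval : PolynomialEvaluation enc F T) :
    InNEXPTIME enc (fun i => (T i).Satisfiable) := by
  classical
  obtain ⟨q, hq⟩ := hsize
  obtain ⟨V⟩ := heval
  -- Bound for the code of a short word: its length times the alphabet size, as a symbol `a` is
  -- coded by `a + 1` bits.
  let ℓ : ℕ → ℕ := fun n => 2 ^ (TransformerEncoder.stateBound.comp q).eval n * q.eval n
  have hℓ : IsExpBounded ℓ := (IsExpBounded.two_pow _).mul (IsExpBounded.eval q)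
  -- The input is moved twice, each guessed bit takes two steps, changes of phase cost a constant,
  -- and the verifier reads at most `n + ℓ n` symbols.
  obtain ⟨r, hr⟩ : IsExpBounded fun n => 2 * n + 2 * ℓ n + 5 + V.time.eval (n + ℓ n) :=
    ((((IsExpBounded.const 2).mul .id).add ((IsExpBounded.const 2).mul hℓ)).add (.const 5)).add
      ((IsExpBounded.id.add hℓ).comp V.time)
  refine ⟨r, GuessAndCheck.machine V.toTM2ComputableAux, fun i => ⟨fun hsat => ?_, fun n hn => ?_⟩⟩
  · obtain ⟨w, hw, hlen⟩ := hsat.exists_short (hnorm i) (hperiodical i)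
    obtain ⟨u, hu⟩ := exists_eq_wordCode (w := w.map Fin.val) (by simpa using hw.ne_nil)
    obtain ⟨n, c, hn, hc, hl, hout⟩ := V.verifierReaches (i, w.map Fin.val)
    have hacc : (T i).AcceptsNat (w.map Fin.val) := ⟨w, rfl, hw⟩
    rw [pairCode_eq_verifierInput hu] at hn hc
    simp only [hacc, decide_true] at hout
    refine ⟨_, ?_, GuessAndCheck.acceptsIn hc hl hout⟩
    have hul : u.length + 1 ≤ ℓ (enc i).length := by
      have h₁ := length_wordCode_le (w := w.map Fin.val) (s := (T i).numSymbols) (by simp)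
      rw [hu, List.length_append, List.length_map] at h₁
      refine h₁.trans (Nat.mul_le_mul ?_ ?_)
      · refine hlen.trans (Nat.pow_le_pow_right two_pos ?_)
        rw [Polynomial.eval_comp]
        exact Polynomial.eval_mono_nat _ (hq i)
      · refine le_trans ?_ (hq i)
        unfold TransformerEncoder.complexity
        omega
    have hnl : n ≤ V.time.eval ((enc i).length + ℓ (enc i).length) := by
      refine hn.trans (Polynomial.eval_mono_nat _ ?_)
      simpa [GuessAndCheck.verifierInput] using hul
    refine le_trans ?_ (hr (enc i).length)
    dsimp only
    omega
  · obtain ⟨u, m, c, hc, hl, hout⟩ := GuessAndCheck.exists_of_acceptsIn hn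
    -- The decoded word may contain symbols outside the alphabet; `AcceptsNat` is then false, so the
    -- output `true` excludes this.
    obtain ⟨w, hw⟩ := exists_wordCode_eq u
    obtain ⟨m', c', -, hc', hl', hout'⟩ := V.verifierReaches (i, w)
    rw [pairCode_eq_verifierInput hw] at hc'
    obtain rfl := hc.eq_of_halted hc' hl hl'
    obtain ⟨w', -, hacc⟩ := of_decide_eq_true (Option.some.inj (hout'.symm.trans hout))
    exact ⟨w', hacc.ne_nil, hacc⟩
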